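/- **Setting.** Let $m\ge 1$, $\theta_k=2\pi k/m$, and let $S=\{R_0,\dots,R_{m-1}\}\le O(2)$ be the group of rotations $R_k$ by $\theta_k$ about the origin of $\mathbb R^2$. An image with $n$ channels is given by its latent function $r:\mathbb R^2\to\mathbb R^{n}$, whose pixel values at mesh size $\delta>0$ are $r(i\delta,j\delta)$, $i,j\in\mathbb Z$ (no boundary effects are modelled); $S$ acts on images by $\pi_R(r)(x)=r(R^{-1}x)$. A feature map is a function $e:\mathbb R^2\times S\to\mathbb R^{n}$, with discretization $F^R_{ij}=e((ih,jh),R)$ at mesh size $h$. **Layers** (at mesh size $h$, with filter size $p$ and filter nodes $x_{ab}=\big((a-\tfrac{p-1}2)h,(b-\tfrac{p-1}2)h\big)$, $0\le a,b<p$). For latent filters $\varphi:\mathbb R^2\to\mathbb R$ (one for each pair of an output channel $c'$ and an input channel $c$, and also for each $A\in S$ in the group convolution), the equivariant convolutions are $$[\text{input}]\quad e_{c'}(x,B)=\sum_{c}\sum_{a,b}\varphi_{c'c}(B^{-1}x_{ab})\,r_c(x-x_{ab}),$$ $$[\text{group}]\quad e'_{c'}(x,B)=\sum_{c}\sum_{A\in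 S}\sum_{a,b}\varphi_{c'c}^{A}(B^{-1}x_{ab})\,e_c(x-x_{ab},BA),$$ $$[\text{output}]\quad r'_{c'}(x)=\sum_{c}\sum_{B\in S}\sum_{a,b}\varphi_{c'c}(B^{-1}x_{ab})\,e_c(x-x_{ab},B).$$ For $x\in\mathbb R^2$ let $i=\lfloor x_1/h\rfloor$, $j=\lfloor x_2/h\rfloor$. Max-pooling is $\Phi_{\rm MP}(F)(x,R)=\max\{F^R_{ij},F^R_{i+1,j},F^R_{i,j+1},F^R_{i+1,j+1}\}$; bilinear upsampling is $\Phi_{\rm BI}(F)(x,R)=\sum_{v,u\in\{0,1\}}\lambda_{vu}(x)F^R_{i+v,j+u}$, where the weights satisfy $\lambda_{vu}(x)\ge0$, $\sum_{v,u}\lambda_{vu}(x)=1$ (for instance the standard bilinear weights). Group normalization acts at each $(x,R)$ on the channel vector $v$ by $v\mapsto\gamma\odot\frac{v-\mu}{\sqrt{\sigma^2+\varepsilon}}+\beta$ with $\varepsilon>0$, where $\mu,\sigma^2$ are the mean and variance over the channel groups of a fixed partition of the channels; $\mathrm{SiLU}(t)=t/(1+e^{-t})$ acts componentwise. **Network.**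 The network with $N\ge2$ convolutional layers, the $l$-th one having $n_l$ output channels ($n_0$ is the number of image channels), is $$\mathrm{ReDiffuse}=\hat\Upsilon\circ\Phi_{\rm BI}^{(d)}\circ\cdots\circ\Phi_{\rm BI}^{(1)}\circ\hat{\mathcal F}\circ\Phi_{\rm MP}^{(d)}\circ\cdots\circ\Phi_{\rm MP}^{(1)}\circ\hat\Psi,$$ where $\hat\Psi$ is an input convolution followed by group convolutions, $\hat{\mathcal F}$ consists of group convolutions, and $\hat\Upsilon$ consists of group convolutions followed by an output convolution (the numbers of group convolutions may be zero). Before and after each convolution, optional fixed group normalizations and SiLU activations may be applied. Pooling multiplies the mesh size by an integer stride $s\ge1$ and upsampling divides it by $s$: $\hat\Psi$, $\hat\Upsilon$ act at mesh size $\delta$, $\Phi_{\rm MP}^{(j)}$ at $s^{j-1}\delta$, $\hat{\mathcal F}$ at $s^d\delta$, and $\Phi_{\rm BI}^{(j)}$ at $s^{d-j+1}\delta$. (Usually $s=2$; for $s=1$ every layer acts at mesh size $\delta$.) **Theorem.** Fix $m$, the architecture ($N$, the sizes of the three stages, $n_0,\dots,n_N$, $p$, $d$, $s$, and the group normalizations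 with their parameters) and constants $F_l,G_l,H_l$, $0\le l\le N$. There is a constant $C_1$, depending only on these data, such that the following holds for every $\delta>0$, all interpolation weights, all latent images $r$ and all latent filters. Assume that the channels $r_c$ of $r$ and the latent filters $\phi_l$ of the $l$-th layer, $1\le l\le N$, are twice differentiable and satisfy for all $x\in\mathbb R^2$ $$|r_c(x)|\le F_0,\quad \|\nabla r_c(x)\|\le G_0,\quad \|\nabla^2 r_c(x)\|\le H_0,$$ $$|\phi_l(x)|\le F_l,\quad \|\nabla\phi_l(x)\|\le G_l,\quad \|\nabla^2\phi_l(x)\|\le H_l,$$ $$\phi_l(x)=0\ \text{ whenever } \|x\|\ge (p+1)\delta_l/2,$$ where $\delta_l$ is the mesh size at which the $l$-th layer acts. Then for all $k=0,\dots,m-1$, all $x\in\mathbb R^2$ and every output channel $c$, $$\left|\mathrm{ReDiffuse}\bigl(\pi_{R_k}(r)\bigr)_c(x)-\pi_{R_k}\bigl[\mathrm{ReDiffuse}(r)\bigr]_c(x)\right|\le C_1\,\delta .$$ -/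

import Mathlib

namespace ReDiffuse

noncomputable section

/-- The spatial domain `ℝ²` with its Euclidean norm. -/
abbrev Plane := EuclideanSpace ℝ (Fin 2)

/-- Latent multi-channel image: value of each of the `n` channels at each point of the plane. -/
abbrev Image (n : ℕ) := Plane → Fin n → ℝ

/-- Latent feature map `(x, R_k) ↦ e(x, R_k) ∈ ℝⁿ`. The rotation group
`S = {R_0, …, R_{m-1}}` is indexed by `ZMod m`, see `rotMatrix_add` and `rotMatrix_injective`. -/
abbrev Feature (m n : ℕ) := Plane → ZMod m → Fin n → ℝ

/-! ### The rotation group and its action -/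

/-- The rotation matrix `R_k` by the angle `θ_k = 2πk/m`. -/
def rotMatrix (m : ℕ) (k : ZMod m) : Matrix (Fin 2) (Fin 2) ℝ :=
  !![Real.cos (2 * Real.pi * k.val / m), -Real.sin (2 * Real.pi * k.val / m);
     Real.sin (2 * Real.pi * k.val / m), Real.cos (2 * Real.pi * k.val / m)]

/-- The point `R_k x`. -/
def rot {m : ℕ} (k : ZMod m) (x : Plane) : Plane :=
  WithLp.toLp 2 ((rotMatrix m k).mulVec x.ofLp)

theorem angle_add (m : ℕ) [NeZero m] (j k : ZMod m) :
    ∃ z : ℤ, 2 * Real.pi * ((j + k).val : ℝ) / m =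
      2 * Real.pi * j.val / m + 2 * Real.pi * k.val / m + z * (2 * Real.pi) := by
  refine ⟨-(((j.val + k.val) / m : ℕ) : ℤ), ?_⟩
  have hm : (m : ℝ) ≠ 0 := Nat.cast_ne_zero.mpr (NeZero.ne m)
  have h1 : ((j + k).val : ℝ) + m * ((j.val + k.val) / m : ℕ) = j.val + k.val := by
    rw [ZMod.val_add]
    exact_mod_cast Nat.mod_add_div (j.val + k.val) m
  have h2 : ((j + k).val : ℝ) = j.val + k.val - m * ((j.val + k.val) / m : ℕ) := by linarith
  rw [h2, Int.cast_neg, Int.cast_natCast]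
  generalize (((j.val + k.val) / m : ℕ) : ℝ) = q
  field_simp
  ring

/-- `k ↦ R_k` turns addition modulo `m` into multiplication of rotations. -/
theorem rotMatrix_add (m : ℕ) [NeZero m] (j k : ZMod m) :
    rotMatrix m (j + k) = rotMatrix m j * rotMatrix m k := by
  obtain ⟨z, hz⟩ := angle_add m j k
  unfold rotMatrix
  rw [hz, Real.cos_add_int_mul_two_pi, Real.sin_add_int_mul_two_pi, Real.cos_add, Real.sin_add]
  ext a b
  fin_cases a <;> fin_cases b <;> simp [Matrix.mul_apply, Fin.sum_univ_two] <;> ring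

theorem rotMatrix_zero (m : ℕ) [NeZero m] : rotMatrix m 0 = 1 := by
  ext a b
  fin_cases a <;> fin_cases b <;> simp [rotMatrix]

/-- `R_{-k}` is the inverse of `R_k`. -/
theorem rotMatrix_neg_mul (m : ℕ) [NeZero m] (k : ZMod m) :
    rotMatrix m (-k) * rotMatrix m k = 1 := by
  rw [← rotMatrix_add, neg_add_cancel, rotMatrix_zero]

/-- The `m` rotations are distinct. -/
theorem rotMatrix_injective (m : ℕ) [NeZero m] : Function.Injective (rotMatrix m) := by
  have hm : (0 : ℝ) < m := Nat.cast_pos.mpr (Nat.pos_of_ne_zero (NeZero.ne m))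
  have key : ∀ k : ZMod m, rotMatrix m k = 1 → k = 0 := by
    intro k hk
    have hc : Real.cos (2 * Real.pi * k.val / m) = 1 := by
      have := congrFun (congrFun hk 0) 0
      simpa [rotMatrix] using this
    have hlt : (k.val : ℝ) < m := Nat.cast_lt.mpr (ZMod.val_lt k)
    have h0 : (0 : ℝ) ≤ k.val := Nat.cast_nonneg _
    have hpi := Real.pi_pos
    have := (Real.cos_eq_one_iff_of_lt_of_lt (x := 2 * Real.pi * k.val / m)
      (by have : 0 ≤ 2 * Real.pi * k.val / m := by positivity
          linarith)
      (by rw [div_lt_iff₀ hm]; exact mul_lt_mul_of_pos_left hlt (by positivity))).1 hc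
    have hz : (k.val : ℝ) = 0 := by
      rcases div_eq_zero_iff.1 this with h | h
      · rcases mul_eq_zero.1 h with h | h
        · linarith
        · exact h
      · exact absurd h hm.ne'
    exact (ZMod.val_eq_zero k).1 (by exact_mod_cast hz)
  intro j k hjk
  have h1 : rotMatrix m (-k + j) = 1 := by
    rw [rotMatrix_add, hjk, rotMatrix_neg_mul]
  have := key _ h1
  rwa [neg_add_eq_zero, eq_comm] at this

/-- The action `[π_{R_k} r](x) = r(R_k⁻¹ x)` of a rotation on images. -/
def rotImage {m n : ℕ} (k : ZMod m) (r : Image n) : Image n := fun x => r (rot (-k) x)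

/-! ### Discretized equivariant convolutions -/

/-- Node `(a, b)` of the centred `p × p` filter grid of mesh size `h`. -/
def node (h : ℝ) (p : ℕ) (a b : Fin p) : Plane :=
  !₂[((a : ℝ) - ((p : ℝ) - 1) / 2) * h, ((b : ℝ) - ((p : ℝ) - 1) / 2) * h]

/-- Input (lifting) convolution: at orientation `R_B` the image is convolved with the `p × p`
filter obtained by sampling the rotated latent filter `y ↦ φ(R_B⁻¹ y)` with mesh size `h`. -/
def liftConv {m n n' : ℕ} (h : ℝ) (p : ℕ) (φ : Fin n' → Fin n → Plane → ℝ) (r : Image n) :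
    Feature m n' :=
  fun x B c' => ∑ c, ∑ a : Fin p, ∑ b : Fin p,
    φ c' c (rot (-B) (node h p a b)) * r (x - node h p a b) c

/-- Intermediate (group) convolution; `B + A` is the index of the product `R_B R_A`. -/
def groupConv {m n n' : ℕ} [NeZero m] (h : ℝ) (p : ℕ)
    (φ : Fin n' → Fin n → ZMod m → Plane → ℝ) (e : Feature m n) : Feature m n' :=
  fun x B c' => ∑ c, ∑ A : ZMod m, ∑ a : Fin p, ∑ b : Fin p,
    φ c' c A (rot (-B) (node h p a b)) * e (x - node h p a b) (B + A) c

/-- Output (projection) convolution, summing over all orientations. -/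
def outConv {m n n' : ℕ} [NeZero m] (h : ℝ) (p : ℕ) (φ : Fin n' → Fin n → Plane → ℝ)
    (e : Feature m n) : Image n' :=
  fun x c' => ∑ c, ∑ B : ZMod m, ∑ a : Fin p, ∑ b : Fin p,
    φ c' c (rot (-B) (node h p a b)) * e (x - node h p a b) B c

/-! ### Max-pooling and bilinear upsampling -/

/-- Discretization `F_{ij}^R = e((ih, jh), R)` with mesh size `h`. -/
def sample {m n : ℕ} (h : ℝ) (e : Feature m n) (i j : ℤ) : ZMod m → Fin n → ℝ :=
  e !₂[(i : ℝ) * h, (j : ℝ) * h]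

/-- Max-pooling of a discrete feature map `F` of mesh size `h`: the maximum over the four corners
of the grid cell that contains `x`. -/
def maxPool {m n : ℕ} (h : ℝ) (F : ℤ → ℤ → ZMod m → Fin n → ℝ) : Feature m n :=
  fun x R c => (Finset.univ : Finset (Fin 2 × Fin 2)).sup' Finset.univ_nonempty fun q =>
    F (⌊x 0 / h⌋ + (q.1 : ℕ)) (⌊x 1 / h⌋ + (q.2 : ℕ)) R c

/-- Interpolation weights: at each point, the four corners of the grid cell receive nonnegative
weights with sum `1`. -/
structure InterpWeights where
  weight : Plane → Fin 2 → Fin 2 → ℝ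
  nonneg : ∀ x v u, 0 ≤ weight x v u
  sum_eq_one : ∀ x, ∑ v, ∑ u, weight x v u = 1

/-- The standard bilinear weights on the grid of mesh size `h`. -/
def InterpWeights.bilinear (h : ℝ) : InterpWeights where
  weight x v u :=
    (if v = 0 then 1 - Int.fract (x 0 / h) else Int.fract (x 0 / h)) *
      (if u = 0 then 1 - Int.fract (x 1 / h) else Int.fract (x 1 / h))
  nonneg x v u := by
    have h0 := Int.fract_nonneg (x 0 / h)
    have h1 := Int.fract_nonneg (x 1 / h)
    have h2 := (Int.fract_lt_one (x 0 / h)).le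
    have h3 := (Int.fract_lt_one (x 1 / h)).le
    refine mul_nonneg ?_ ?_ <;> split_ifs <;> linarith
  sum_eq_one x := by
    simp only [Fin.sum_univ_two]
    simp
    ring

/-- Bilinear interpolation of a discrete feature map `F` of mesh size `h`. -/
def upsample {m n : ℕ} (h : ℝ) (w : InterpWeights) (F : ℤ → ℤ → ZMod m → Fin n → ℝ) :
    Feature m n :=
  fun x R c => ∑ v : Fin 2, ∑ u : Fin 2, w.weight x v u *
    F (⌊x 0 / h⌋ + (v : ℕ)) (⌊x 1 / h⌋ + (u : ℕ)) R c

/-! ### Group normalization and SiLU -/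

/-- Parameters of a group normalization on `n` channels; `group` assigns to each channel the label
of its class in the partition of the channels. -/
structure GroupNorm (n : ℕ) where
  group : Fin n → ℕ
  gamma : Fin n → ℝ
  beta : Fin n → ℝ
  eps : ℝ
  eps_pos : 0 < eps

/-- The class of the channel `c`. -/
def GroupNorm.cls {n : ℕ} (g : GroupNorm n) (c : Fin n) : Finset (Fin n) :=
  Finset.univ.filter fun d => g.group d = g.group c

/-- Mean over the class of the channel `c`. -/
def GroupNorm.mean {n : ℕ} (g : GroupNorm n) (v : Fin n → ℝ) (c : Fin n) : ℝ :=
  (∑ d ∈ g.cls c, v d) / (g.cls c).card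

/-- Variance over the class of the channel `c`. -/
def GroupNorm.var {n : ℕ} (g : GroupNorm n) (v : Fin n → ℝ) (c : Fin n) : ℝ :=
  (∑ d ∈ g.cls c, (v d - g.mean v c) ^ 2) / (g.cls c).card

/-- Group normalization of the channel vector at one point. -/
def GroupNorm.apply {n : ℕ} (g : GroupNorm n) (v : Fin n → ℝ) : Fin n → ℝ :=
  fun c => g.gamma c * ((v c - g.mean v c) / Real.sqrt (g.var v c + g.eps)) + g.beta c

/-- `SiLU(t) = t · sigmoid(t)`. -/
def silu (t : ℝ) : ℝ := t / (1 + Real.exp (-t))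

/-- A pointwise module: an optional group normalization followed by an optional SiLU. -/
structure PointwiseOp (n : ℕ) where
  norm : Option (GroupNorm n)
  act : Bool

def PointwiseOp.apply {n : ℕ} (P : PointwiseOp n) (v : Fin n → ℝ) : Fin n → ℝ :=
  let u : Fin n → ℝ := match P.norm with
    | none => v
    | some g => g.apply v
  if P.act then fun c => silu (u c) else u

/-! ### The network -/

/-- Architecture of the network. The convolutional layers number `0, …, N - 1`; layer `l` maps
`chan l` channels to `chan (l + 1)` channels. The input stage consists of the lifting convolution
and `kIn` group convolutions, the middle stage of `kMid` group convolutions, the output stage of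
`kOut` group convolutions and the output convolution. -/
structure Arch where
  kIn : ℕ
  kMid : ℕ
  kOut : ℕ
  /-- number of pooling layers, and of upsampling layers -/
  depth : ℕ
  /-- stride of each pooling layer, factor of each upsampling layer -/
  stride : ℕ
  stride_pos : 1 ≤ stride
  /-- filter size -/
  p : ℕ
  chan : ℕ → ℕ
  /-- normalization and activation before layer `l` -/
  pre : ∀ l, PointwiseOp (chan l)
  /-- normalization and activation after layer `l` -/
  post : ∀ l, PointwiseOp (chan (l + 1))

/-- The index of the output convolution, so that there are `N = last + 1` layers. -/
abbrev Arch.last (U : Arch) : ℕ := 1 + U.kIn + U.kMid + U.kOut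

/-- The mesh size of the feature maps on which layer `l` acts: it is `stride ^ depth * δ` in the
middle stage, between pooling and upsampling, and `δ` in the other two stages. -/
def Arch.mesh (U : Arch) (δ : ℝ) (l : ℕ) : ℝ :=
  if 1 + U.kIn ≤ l ∧ l < 1 + U.kIn + U.kMid then (U.stride : ℝ) ^ U.depth * δ else δ

/-- The latent functions of all filters of the network; `mid l` is used for the layers
`0 < l < U.last`. -/
structure Filters (U : Arch) (m : ℕ) where
  lift : Fin (U.chan 1) → Fin (U.chan 0) → Plane → ℝ
  mid : ∀ l, Fin (U.chan (l + 1)) → Fin (U.chan l) → ZMod m → Plane → ℝ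
  out : Fin (U.chan (U.last + 1)) → Fin (U.chan U.last) → Plane → ℝ

section Network

variable {m : ℕ} [NeZero m] (U : Arch) (δ : ℝ) (φ : Filters U m)

/-- The first layer. -/
def firstLayer (r : Image (U.chan 0)) : Feature m (U.chan 1) :=
  fun x R => (U.post 0).apply
    (liftConv (U.mesh δ 0) U.p φ.lift (fun y => (U.pre 0).apply (r y)) x R)

/-- Layer `l`, an intermediate one. -/
def midLayer (l : ℕ) (e : Feature m (U.chan l)) : Feature m (U.chan (l + 1)) :=
  fun x R => (U.post l).apply
    (groupConv (U.mesh δ l) U.p (φ.mid l) (fun y Q => (U.pre l).apply (e y Q)) x R)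

/-- The last layer. -/
def lastLayer (e : Feature m (U.chan U.last)) : Image (U.chan (U.last + 1)) :=
  fun x => (U.post U.last).apply
    (outConv (U.mesh δ U.last) U.p φ.out (fun y Q => (U.pre U.last).apply (e y Q)) x)

/-- The `k` consecutive intermediate layers `l, l + 1, …, l + k - 1`. -/
def midStack (l : ℕ) : (k : ℕ) → Feature m (U.chan l) → Feature m (U.chan (l + k))
  | 0, e => e
  | k + 1, e => midLayer U δ φ (l + k) (midStack l k e)

/-- The first `k` pooling layers. The `j`-th one, `j = 0, 1, …`, acts on mesh size
`s ^ j * δ` and its output is used on mesh size `s ^ (j + 1) * δ`. -/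
def poolStack {n : ℕ} (s : ℕ) : ℕ → Feature m n → Feature m n
  | 0, e => e
  | k + 1, e => maxPool ((s : ℝ) ^ k * δ) (sample ((s : ℝ) ^ k * δ) (poolStack s k e))

/-- The last `k` upsampling layers: they act on the mesh sizes `s ^ k * δ, …, s * δ`, in this
order. -/
def upStack {n : ℕ} (s : ℕ) (w : ℕ → InterpWeights) : ℕ → Feature m n → Feature m n
  | 0, e => e
  | k + 1, e => upStack s w k
      (upsample ((s : ℝ) ^ (k + 1) * δ) (w k) (sample ((s : ℝ) ^ (k + 1) * δ) e))

/-- The network: input stage, pooling, middle stage, upsampling, output stage. -/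
def network (w : ℕ → InterpWeights) (r : Image (U.chan 0)) : Image (U.chan (U.last + 1)) :=
  lastLayer U δ φ
    (midStack U δ φ (1 + U.kIn + U.kMid) U.kOut
      (upStack δ U.stride w U.depth
        (midStack U δ φ (1 + U.kIn) U.kMid
          (poolStack δ U.stride U.depth
            (midStack U δ φ 1 U.kIn
              (firstLayer U δ φ r))))))

end Network

/-! ### The network is a map of discretized images

For odd filter size, the values of the output on the pixel grid depend only on the values of the
input on the pixel grid. -/

theorem exists_grid_sub_node (h : ℝ) {p q : ℕ} (hp : p = 2 * q + 1) (i j : ℤ) (a b : Fin p) :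
    ∃ i' j' : ℤ, !₂[(i : ℝ) * h, (j : ℝ) * h] - node h p a b =
      (!₂[(i' : ℝ) * h, (j' : ℝ) * h] : Plane) := by
  subst hp
  refine ⟨i - (a : ℕ) + q, j - (b : ℕ) + q, ?_⟩
  ext t
  fin_cases t <;> simp [node] <;> ring

theorem poolStack_congr_grid {m n : ℕ} {δ : ℝ} (s k : ℕ) {e e' : Feature m n}
    (he : sample δ e = sample δ e') :
    sample ((s : ℝ) ^ k * δ) (poolStack δ s k e) =
      sample ((s : ℝ) ^ k * δ) (poolStack δ s k e') := by
  induction k with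
  | zero => simpa [poolStack] using he
  | succ k ih => simp only [poolStack, ih]

theorem upStack_congr_grid {m n : ℕ} {δ : ℝ} (s k : ℕ) (w : ℕ → InterpWeights) {e e' : Feature m n}
    (he : sample ((s : ℝ) ^ k * δ) e = sample ((s : ℝ) ^ k * δ) e') :
    sample δ (upStack δ s w k e) = sample δ (upStack δ s w k e') := by
  cases k with
  | zero => simpa [upStack] using he
  | succ k => simp only [upStack, he]

section Network

variable {m : ℕ} [NeZero m] {U : Arch} {δ : ℝ} {φ : Filters U m} {q : ℕ}

theorem midStack_congr_grid (hp : U.p = 2 * q + 1) {h : ℝ} {l k : ℕ}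
    (hh : ∀ t < k, U.mesh δ (l + t) = h) {e e' : Feature m (U.chan l)}
    (he : sample h e = sample h e') :
    sample h (midStack U δ φ l k e) = sample h (midStack U δ φ l k e') := by
  induction k with
  | zero => exact he
  | succ k ih =>
    have ih := ih fun t ht => hh t (by omega)
    funext i j R
    simp only [sample, midStack, midLayer, hh k (by omega)]
    congr 1
    funext c'
    simp only [groupConv]
    refine Finset.sum_congr rfl fun c _ => Finset.sum_congr rfl fun A _ =>
      Finset.sum_congr rfl fun a _ => Finset.sum_congr rfl fun b _ => ?_
    obtain ⟨i', j', hij⟩ := exists_grid_sub_node h hp i j a b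
    rw [hij]
    have := congrFun (congrFun (congrFun ih i') j') (R + A)
    simp only [sample] at this
    rw [this]

theorem network_congr_grid (hp : U.p = 2 * q + 1) (w : ℕ → InterpWeights)
    {r r' : Image (U.chan 0)}
    (hr : ∀ i j : ℤ, r !₂[(i : ℝ) * δ, (j : ℝ) * δ] = r' !₂[(i : ℝ) * δ, (j : ℝ) * δ])
    (i j : ℤ) :
    network U δ φ w r !₂[(i : ℝ) * δ, (j : ℝ) * δ] =
      network U δ φ w r' !₂[(i : ℝ) * δ, (j : ℝ) * δ] := by
  have h0 : U.mesh δ 0 = δ := by simp [Arch.mesh]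
  have h1 : sample δ (firstLayer U δ φ r) = sample δ (firstLayer U δ φ r') := by
    funext i j R
    simp only [sample, firstLayer, h0]
    congr 1
    funext c'
    simp only [liftConv]
    refine Finset.sum_congr rfl fun c _ =>
      Finset.sum_congr rfl fun a _ => Finset.sum_congr rfl fun b _ => ?_
    obtain ⟨i', j', hij⟩ := exists_grid_sub_node δ hp i j a b
    rw [hij, hr]
  have h2 := midStack_congr_grid (φ := φ) (k := U.kIn) hp
    (fun t ht => by simp only [Arch.mesh]; rw [if_neg]; omega) h1
  have h3 := poolStack_congr_grid U.stride U.depth h2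
  have h4 := midStack_congr_grid (φ := φ) (k := U.kMid) hp
    (fun t ht => by simp only [Arch.mesh]; rw [if_pos]; omega) h3
  have h5 := upStack_congr_grid U.stride U.depth w h4
  have h6 := midStack_congr_grid (φ := φ) (k := U.kOut) hp
    (fun t ht => by simp only [Arch.mesh]; rw [if_neg]; omega) h5
  have hl : U.mesh δ U.last = δ := by simp only [Arch.mesh, Arch.last]; rw [if_neg]; omega
  unfold network
  simp only [lastLayer, hl]
  congr 1
  funext c'
  simp only [outConv]
  refine Finset.sum_congr rfl fun c _ => Finset.sum_congr rfl fun A _ =>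
    Finset.sum_congr rfl fun a _ => Finset.sum_congr rfl fun b _ => ?_
  obtain ⟨i', j', hij⟩ := exists_grid_sub_node δ hp i j a b
  rw [hij]
  have := congrFun (congrFun (congrFun h6 i') j') A
  simp only [sample] at this
  rw [this]

end Network

/-! ### Regularity assumptions -/

/-- `f` is twice differentiable and `F`, `G`, `H` bound `|f|`, its gradient and its Hessian. -/
structure BoundedToOrderTwo (f : Plane → ℝ) (F G H : ℝ) : Prop where
  diff : Differentiable ℝ f
  diff_gradient : Differentiable ℝ (gradient f)
  bound : ∀ x, |f x| ≤ F
  bound_gradient : ∀ x, ‖gradient f x‖ ≤ G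
  bound_hessian : ∀ x, ‖fderiv ℝ (gradient f) x‖ ≤ H

/-- `f` is an admissible latent function of a filter of size `p` at mesh size `h`. -/
structure AdmissibleFilter (p : ℕ) (h F G H : ℝ) (f : Plane → ℝ) : Prop where
  bounded : BoundedToOrderTwo f F G H
  support : ∀ x, ((p : ℝ) + 1) * h / 2 ≤ ‖x‖ → f x = 0

/-- All filters are admissible; the filters of layer `l` obey the bounds with index `l + 1`, since
index `0` belongs to the image. -/
structure Filters.Admissible {U : Arch} {m : ℕ} (φ : Filters U m) (δ : ℝ) (F G H : ℕ → ℝ) :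
    Prop where
  lift : ∀ c' c, AdmissibleFilter U.p (U.mesh δ 0) (F 1) (G 1) (H 1) (φ.lift c' c)
  mid : ∀ l, 0 < l → l < U.last → ∀ c' c A,
    AdmissibleFilter U.p (U.mesh δ l) (F (l + 1)) (G (l + 1)) (H (l + 1)) (φ.mid l c' c A)
  out : ∀ c' c, AdmissibleFilter U.p (U.mesh δ U.last)
    (F (U.last + 1)) (G (U.last + 1)) (H (U.last + 1)) (φ.out c' c)

end

end ReDiffuse

open ReDiffuse

open ReDiffuse

namespace ReDiffuse

/-! ### Rotations and filter nodes -/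

/-! No comparison with a continuous convolution is needed: to first order in `δ` the grid has no
spatial extent. Every filter node has norm `O(δ)`, so rotating a node moves it by `O(δ)`, which
changes a filter value by at most its gradient bound times `O(δ)`. A feature that is Lipschitz up to
`O(δ)` likewise changes by `O(δ)` between `x` and `x - ν` for a node `ν`. Each convolution has a
fixed number of terms, so the errors add up to `O(δ)`.

The induction runs over the layers with the invariant `NearEquivariant`: both feature maps are
bounded and slowly varying, and they agree up to `M * δ` after rotating the point by `R_k⁻¹` and
shifting the orientation by `-k`. The additive `δ` in the oscillation bound cannot be dropped,
because pooling produces piecewise constant, discontinuous maps.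

Three lemmas carry the invariant through the layers, each with a new constant independent of `δ`:
`NearEquivariant.pointwise` (normalization and SiLU are Lipschitz on balls),
`NearEquivariant.latentSum` (all three convolutions), and `NearEquivariant.localAverage` (pooling
and upsampling move values by `O(δ)`). An image and its rotation start the induction with zero
equivariance error. -/

theorem rot_sub {m : ℕ} (k : ZMod m) (x y : Plane) : rot k (x - y) = rot k x - rot k y := by
  simp only [rot, WithLp.ofLp_sub, Matrix.mulVec_sub, WithLp.toLp_sub]

theorem norm_rot {m : ℕ} (k : ZMod m) (x : Plane) : ‖rot k x‖ = ‖x‖ := by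
  rw [EuclideanSpace.norm_eq, EuclideanSpace.norm_eq]
  congr 1
  simp only [rot, rotMatrix, Fin.sum_univ_two, Real.norm_eq_abs, sq_abs, Matrix.mulVec,
    dotProduct, Matrix.of_apply, Matrix.cons_val', Matrix.cons_val_zero, Matrix.cons_val_one,
    Matrix.cons_val_fin_one]
  have := Real.sin_sq_add_cos_sq (2 * Real.pi * (k.val : ℝ) / m)
  linear_combination (x 0 ^ 2 + x 1 ^ 2) * this

theorem norm_le_abs_add_abs (x : Plane) : ‖x‖ ≤ |x 0| + |x 1| := by
  rw [EuclideanSpace.norm_eq, Fin.sum_univ_two]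
  refine Real.sqrt_le_iff.2 ⟨by positivity, ?_⟩
  simp only [Real.norm_eq_abs]
  nlinarith [abs_nonneg (x 0), abs_nonneg (x 1)]

theorem norm_node_le {h : ℝ} (hh : 0 ≤ h) {p : ℕ} (a b : Fin p) : ‖node h p a b‖ ≤ 2 * p * h := by
  have key : ∀ a : Fin p, |((a : ℝ) - ((p : ℝ) - 1) / 2) * h| ≤ p * h := by
    intro a
    have h0 : (0 : ℝ) ≤ (a : ℕ) := Nat.cast_nonneg _
    have h1 : ((a : ℕ) : ℝ) + 1 ≤ p := by exact_mod_cast a.2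
    rw [abs_mul, abs_of_nonneg hh]
    refine mul_le_mul_of_nonneg_right (abs_le.2 ⟨?_, ?_⟩) hh <;> linarith
  have h2 := norm_le_abs_add_abs (node h p a b)
  have ha := key a
  have hb := key b
  simp only [node, PiLp.toLp_apply, Matrix.cons_val_zero, Matrix.cons_val_one,
    Matrix.cons_val_fin_one] at h2
  simp only [node]
  linarith

/-! ### Pointwise modules are Lipschitz on bounded sets -/

theorem contDiff_silu : ContDiff ℝ 1 silu := by
  unfold silu
  refine contDiff_id.div (by fun_prop) fun t => ?_
  positivity

theorem GroupNorm.var_nonneg {n : ℕ} (g : GroupNorm n) (v : Fin n → ℝ) (c : Fin n) :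
    0 ≤ g.var v c := by
  unfold GroupNorm.var
  positivity

theorem GroupNorm.contDiff_mean {n : ℕ} (g : GroupNorm n) (c : Fin n) :
    ContDiff ℝ 1 fun v => g.mean v c := by
  unfold GroupNorm.mean
  exact (ContDiff.sum fun d _ => contDiff_apply ℝ ℝ d).div_const _

theorem GroupNorm.contDiff_var {n : ℕ} (g : GroupNorm n) (c : Fin n) :
    ContDiff ℝ 1 fun v => g.var v c := by
  unfold GroupNorm.var
  exact (ContDiff.sum fun d _ =>
    ((contDiff_apply ℝ ℝ d).sub (g.contDiff_mean c)).pow 2).div_const _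

/-- Since `eps > 0`, the argument of the square root never vanishes, so both the root and the
quotient are smooth. -/
theorem GroupNorm.contDiff_apply {n : ℕ} (g : GroupNorm n) : ContDiff ℝ 1 g.apply := by
  refine contDiff_pi.2 fun c => ?_
  have hpos : ∀ v, 0 < g.var v c + g.eps := fun v => add_pos_of_nonneg_of_pos
    (g.var_nonneg v c) g.eps_pos
  unfold GroupNorm.apply
  refine (contDiff_const.mul (ContDiff.div ((_root_.contDiff_apply ℝ ℝ c).sub (g.contDiff_mean c))
    (((g.contDiff_var c).add contDiff_const).sqrt fun v => (hpos v).ne') fun v => ?_)).add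
    contDiff_const
  exact (Real.sqrt_pos.2 (hpos v)).ne'

theorem PointwiseOp.contDiff_apply {n : ℕ} (P : PointwiseOp n) : ContDiff ℝ 1 P.apply := by
  have act : ∀ (b : Bool) (u : (Fin n → ℝ) → Fin n → ℝ), ContDiff ℝ 1 u →
      ContDiff ℝ 1 fun v => if b then fun c => silu (u v c) else u v := by
    intro b u hu
    cases b with
    | false => simpa using hu
    | true => simpa using contDiff_pi.2 fun c => contDiff_silu.comp (contDiff_pi.1 hu c)
  obtain ⟨_ | g, b⟩ := P
  · exact act b _ contDiff_id
  · exact act b _ g.contDiff_apply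

/-- A `C¹` map is Lipschitz on a compact convex set. A ball is enough, as the feature maps stay
uniformly bounded. -/
theorem PointwiseOp.exists_lipschitz {n : ℕ} (P : PointwiseOp n) (M : ℝ) :
    ∃ L : ℝ, 0 ≤ L ∧ ∀ v w : Fin n → ℝ, ‖v‖ ≤ M → ‖w‖ ≤ M →
      ‖P.apply v - P.apply w‖ ≤ L * ‖v - w‖ := by
  obtain ⟨L, hL⟩ := P.contDiff_apply.contDiffOn.exists_lipschitzOnWith (by norm_num)
    (convex_closedBall (0 : Fin n → ℝ) M) (isCompact_closedBall 0 M)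
  exact ⟨L, L.2, fun v w hv hw => hL.norm_sub_le (by simpa using hv) (by simpa using hw)⟩

/-! ### Lipschitz bounds from gradient bounds -/

theorem BoundedToOrderTwo.abs_sub_le {f : Plane → ℝ} {F G H : ℝ} (hf : BoundedToOrderTwo f F G H)
    (x y : Plane) : |f x - f y| ≤ G * ‖x - y‖ := by
  rw [← Real.norm_eq_abs]
  refine convex_univ.norm_image_sub_le_of_norm_fderiv_le (𝕜 := ℝ) (fun z _ => hf.diff z)
    (fun z _ => ?_) (Set.mem_univ y) (Set.mem_univ x)
  -- The gradient is the Riesz representative of the derivative, so the two norms agree.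
  have := hf.bound_gradient z
  rwa [gradient, LinearIsometryEquiv.norm_map] at this

/-! ### Approximately equivariant pairs of feature maps -/

/-- `e` is bounded by `M`, and Lipschitz with constant `M` up to an error `M * δ`. -/
structure SlowlyVarying {m n : ℕ} (δ M : ℝ) (e : Feature m n) : Prop where
  bound : ∀ x B, ‖e x B‖ ≤ M
  osc : ∀ x y B, ‖e x B - e y B‖ ≤ M * (‖x - y‖ + δ)

/-- `e` and `e'` are slowly varying, and `e` is the rotation of `e'` by `R_k` up to an error
`M * δ`. -/
structure NearEquivariant {m n : ℕ} (k : ZMod m) (δ M : ℝ) (e e' : Feature m n) : Prop where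
  left : SlowlyVarying δ M e
  right : SlowlyVarying δ M e'
  close : ∀ x B, ‖e x B - e' (rot (-k) x) (B - k)‖ ≤ M * δ

theorem SlowlyVarying.nonneg {m n : ℕ} {δ M : ℝ} {e : Feature m n} (he : SlowlyVarying δ M e) :
    0 ≤ M :=
  (norm_nonneg _).trans (he.bound 0 0)

/-- A pointwise module preserves approximate equivariance. -/
theorem NearEquivariant.pointwise {n : ℕ} (P : PointwiseOp n) (M : ℝ) :
    ∃ M', ∀ (m : ℕ) (k : ZMod m) (δ : ℝ), 0 < δ → ∀ e e' : Feature m n,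
      NearEquivariant k δ M e e' →
        NearEquivariant k δ M' (fun x B => P.apply (e x B)) (fun x B => P.apply (e' x B)) := by
  -- The ball has to contain `0`, where the bound on `P.apply` is anchored, and `M` has no sign yet.
  obtain ⟨L, hL, hP⟩ := P.exists_lipschitz (max M 0)
  have hLM : L * M ≤ ‖P.apply 0‖ + L * M := le_add_of_nonneg_left (norm_nonneg _)
  have slow : ∀ (m : ℕ) (δ : ℝ), 0 < δ → ∀ e : Feature m n, SlowlyVarying δ M e →
      SlowlyVarying δ (‖P.apply 0‖ + L * M) (fun x B => P.apply (e x B)) := by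
    intro m δ hδ e he
    have hb : ∀ x B, ‖e x B‖ ≤ max M 0 := fun x B => (he.bound x B).trans (le_max_left _ _)
    refine ⟨fun x B => ?_, fun x y B => ?_⟩
    · have h1 := hP (e x B) 0 (hb x B) (by simp)
      rw [sub_zero, norm_sub_rev] at h1
      have h2 := norm_le_norm_add_norm_sub (P.apply 0) (P.apply (e x B))
      have h3 := mul_le_mul_of_nonneg_left (he.bound x B) hL
      linarith
    · calc ‖P.apply (e x B) - P.apply (e y B)‖ ≤ L * ‖e x B - e y B‖ := hP _ _ (hb x B) (hb y B)
        _ ≤ L * (M * (‖x - y‖ + δ)) := mul_le_mul_of_nonneg_left (he.osc x y B) hL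
        _ = L * M * (‖x - y‖ + δ) := by ring
        _ ≤ _ := mul_le_mul_of_nonneg_right hLM (by positivity)
  refine ⟨‖P.apply 0‖ + L * M, fun m k δ hδ e e' h => ⟨slow m δ hδ e h.left,
    slow m δ hδ e' h.right, fun x B => ?_⟩⟩
  calc ‖P.apply (e x B) - P.apply (e' (rot (-k) x) (B - k))‖
      ≤ L * ‖e x B - e' (rot (-k) x) (B - k)‖ :=
        hP _ _ ((h.left.bound _ _).trans (le_max_left _ _))
          ((h.right.bound _ _).trans (le_max_left _ _))
    _ ≤ L * (M * δ) := mul_le_mul_of_nonneg_left (h.close x B) hL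
    _ = L * M * δ := by ring
    _ ≤ _ := mul_le_mul_of_nonneg_right hLM hδ.le

/-! ### Convolutions -/

/-- The common form of the three convolutions: a weighted sum over translates by `ν i`, at the
orientations `B + a i`, of the channels `κ i`. -/
def filterSum {m n n' : ℕ} {ι : Type} [Fintype ι] (W : ZMod m → Fin n' → ι → ℝ) (ν : ι → Plane)
    (a : ι → ZMod m) (κ : ι → Fin n) (e : Feature m n) : Feature m n' :=
  fun x B c' => ∑ i, W B c' i * e (x - ν i) (B + a i) (κ i)

theorem abs_sum_mul_le {ι : Type} [Fintype ι] {w u : ι → ℝ} {A E : ℝ} (hw : ∀ i, |w i| ≤ A)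
    (hu : ∀ i, |u i| ≤ E) : |∑ i, w i * u i| ≤ Fintype.card ι * (A * E) := by
  refine (Finset.abs_sum_le_sum_abs _ _).trans ?_
  rw [← nsmul_eq_mul, Fintype.card]
  refine Finset.sum_le_card_nsmul _ _ _ fun i _ => ?_
  rw [abs_mul]
  exact mul_le_mul (hw i) (hu i) (abs_nonneg _) ((abs_nonneg _).trans (hw i))

/-- From `w u - w' u' = w (u - u') + (w - w') u'`: the error of the features is weighted by the
filter bound, the error of the filters by the feature bound. -/
theorem abs_sum_mul_sub_sum_mul_le {ι : Type} [Fintype ι] {w w' u u' : ι → ℝ} {A D E M : ℝ}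
    (hw : ∀ i, |w i| ≤ A) (hww : ∀ i, |w i - w' i| ≤ D) (hu : ∀ i, |u' i| ≤ M)
    (huu : ∀ i, |u i - u' i| ≤ E) :
    |∑ i, w i * u i - ∑ i, w' i * u' i| ≤ Fintype.card ι * (A * E + D * M) := by
  have h : ∑ i, w i * u i - ∑ i, w' i * u' i =
      ∑ i, w i * (u i - u' i) + ∑ i, (w i - w' i) * u' i := by
    rw [← Finset.sum_sub_distrib, ← Finset.sum_add_distrib]
    exact Finset.sum_congr rfl fun i _ => by ring
  rw [h, mul_add]
  exact (abs_add_le _ _).trans (add_le_add (abs_sum_mul_le hw huu) (abs_sum_mul_le hww hu))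

theorem abs_apply_le_norm {n : ℕ} (v : Fin n → ℝ) (c : Fin n) : |v c| ≤ ‖v‖ := norm_le_pi_norm v c

/-- Translating `x` and `y` by the same node preserves `x - y`, and the weights coincide, so each
term inherits the oscillation bound. -/
theorem SlowlyVarying.filterSum {m n n' : ℕ} {ι : Type} [Fintype ι]
    {W : ZMod m → Fin n' → ι → ℝ} {ν : ι → Plane} (a : ι → ZMod m) (κ : ι → Fin n)
    {A δ M : ℝ} (hδ : 0 < δ) (hA : 0 ≤ A) (hW : ∀ B c' i, |W B c' i| ≤ A) {e : Feature m n}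
    (h : SlowlyVarying δ M e) :
    SlowlyVarying δ (Fintype.card ι * (A * M)) (filterSum W ν a κ e) := by
  have hM := h.nonneg
  refine ⟨fun x B => (pi_norm_le_iff_of_nonneg (by positivity)).2 fun c' => ?_,
    fun x y B => (pi_norm_le_iff_of_nonneg (by positivity)).2 fun c' => ?_⟩
  · exact abs_sum_mul_le (hW B c') fun i => (abs_apply_le_norm _ _).trans (h.bound _ _)
  · have := abs_sum_mul_sub_sum_mul_le (w := W B c') (w' := W B c')
      (u := fun i => e (x - ν i) (B + a i) (κ i)) (u' := fun i => e (y - ν i) (B + a i) (κ i))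
      (D := 0) (E := M * (‖x - y‖ + δ)) (hW B c') (fun i => by simp)
      (fun i => (abs_apply_le_norm _ _).trans (h.bound _ _))
      (fun i => by
        have := (abs_apply_le_norm _ (κ i)).trans (h.osc (x - ν i) (y - ν i) (B + a i))
        rwa [sub_sub_sub_cancel_right] at this)
    refine this.trans (le_of_eq ?_)
    ring

/-- The nodes are not rotated along with the image. The terms with the same index are compared
directly: weights at any two orientations differ by `D * δ`, and shifts by nodes of norm at most `E
* δ` are absorbed by slow variation. -/
theorem NearEquivariant.filterSum {m n n' : ℕ} {ι : Type} [Fintype ι]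
    {W : ZMod m → Fin n' → ι → ℝ} {ν : ι → Plane} (a : ι → ZMod m) (κ : ι → Fin n)
    {A D E δ M : ℝ} (hδ : 0 < δ) (hA : 0 ≤ A) (hD : 0 ≤ D) (hE : 0 ≤ E)
    (hW : ∀ B c' i, |W B c' i| ≤ A) (hWW : ∀ B B' c' i, |W B c' i - W B' c' i| ≤ D * δ)
    (hν : ∀ i, ‖ν i‖ ≤ E * δ) {k : ZMod m} {e e' : Feature m n} (h : NearEquivariant k δ M e e') :
    NearEquivariant k δ (Fintype.card ι * (A * ((2 * E + 3) * M) + D * M))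
      (filterSum W ν a κ e) (filterSum W ν a κ e') := by
  have hM := h.left.nonneg
  -- One constant has to serve all three fields of the invariant; the closeness estimate gives the
  -- largest.
  have hle : Fintype.card ι * (A * M) ≤ Fintype.card ι * (A * ((2 * E + 3) * M) + D * M) := by
    refine mul_le_mul_of_nonneg_left ?_ (Nat.cast_nonneg _)
    have h1 : M ≤ (2 * E + 3) * M := le_mul_of_one_le_left hM (by linarith)
    have h2 := mul_le_mul_of_nonneg_left h1 hA
    have h3 := mul_nonneg hD hM
    linarith
  have slow : ∀ e : Feature m n, SlowlyVarying δ M e →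
      SlowlyVarying δ (Fintype.card ι * (A * ((2 * E + 3) * M) + D * M))
        (ReDiffuse.filterSum W ν a κ e) := fun e he =>
    ⟨fun x B => ((he.filterSum a κ hδ hA hW).bound x B).trans hle, fun x y B =>
      ((he.filterSum a κ hδ hA hW).osc x y B).trans (mul_le_mul_of_nonneg_right hle (by positivity))⟩
  refine ⟨slow e h.left, slow e' h.right, fun x B =>
    (pi_norm_le_iff_of_nonneg (by positivity)).2 fun c' => ?_⟩
  -- Path from `e (x - ν i)` through `e x` and `e' (rot (-k) x)` to `e' (rot (-k) x - ν i)`: the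
  -- costs `(E + 1) + 1 + (E + 1)` make up the factor `2 * E + 3`.
  have := abs_sum_mul_sub_sum_mul_le (w := W B c') (w' := W (B - k) c')
      (u := fun i => e (x - ν i) (B + a i) (κ i))
      (u' := fun i => e' (rot (-k) x - ν i) (B - k + a i) (κ i))
      (D := D * δ) (E := (2 * E + 3) * M * δ) (hW B c') (hWW B (B - k) c')
      (fun i => (abs_apply_le_norm _ _).trans (h.right.bound _ _))
      (fun i => by
        refine (abs_apply_le_norm (e (x - ν i) (B + a i) - e' (rot (-k) x - ν i) (B - k + a i))
          (κ i)).trans ?_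
        have h1 := h.left.osc (x - ν i) x (B + a i)
        have h2 := h.close x (B + a i)
        have h3 := h.right.osc (rot (-k) x) (rot (-k) x - ν i) (B - k + a i)
        rw [sub_sub_cancel_left, norm_neg] at h1
        rw [sub_sub_cancel] at h3
        rw [show B + a i - k = B - k + a i by ring] at h2
        have h4 := mul_le_mul_of_nonneg_left (hν i) hM
        have h5 := norm_sub_le_norm_sub_add_norm_sub (e (x - ν i) (B + a i)) (e x (B + a i))
          (e' (rot (-k) x - ν i) (B - k + a i))
        have h6 := norm_sub_le_norm_sub_add_norm_sub (e x (B + a i))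
          (e' (rot (-k) x) (B - k + a i)) (e' (rot (-k) x - ν i) (B - k + a i))
        linarith)
  refine this.trans (le_of_eq ?_)
  ring

/-! ### Pooling and upsampling -/

/-- An operator whose value at `x` is an average of values of its argument at distance at most
`2 * h`. -/
def IsLocalAverage {m n : ℕ} (h : ℝ) (T : Feature m n → Feature m n) : Prop :=
  ∀ e x B c c₀ η, (∀ y, ‖y - x‖ ≤ 2 * h → |e y B c - c₀| ≤ η) → |T e x B c - c₀| ≤ η

theorem norm_corner_sub_le {h : ℝ} (hh : 0 < h) (x : Plane) (v u : Fin 2) :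
    ‖(!₂[((⌊x 0 / h⌋ + (v : ℕ) : ℤ) : ℝ) * h, ((⌊x 1 / h⌋ + (u : ℕ) : ℤ) : ℝ) * h] : Plane) - x‖
      ≤ 2 * h := by
  have key : ∀ (t : ℝ) (v : Fin 2), |((⌊t / h⌋ + (v : ℕ) : ℤ) : ℝ) * h - t| ≤ h := by
    intro t v
    have h1 : (⌊t / h⌋ : ℝ) * h ≤ t := (le_div_iff₀ hh).1 (Int.floor_le _)
    have h2 : t < ((⌊t / h⌋ : ℝ) + 1) * h := (div_lt_iff₀ hh).1 (Int.lt_floor_add_one _)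
    fin_cases v <;> simp <;> rw [abs_le] <;> constructor <;> linarith
  refine (norm_le_abs_add_abs _).trans ?_
  have h0 := key (x 0) v
  have h1 := key (x 1) u
  simp only [PiLp.sub_apply, Matrix.cons_val_zero, Matrix.cons_val_one,
    Matrix.cons_val_fin_one]
  linarith

/-- A maximum lies in every interval that contains all four corner values; any single corner gives
the lower bound. -/
theorem isLocalAverage_maxPool {m n : ℕ} {h : ℝ} (hh : 0 < h) :
    IsLocalAverage h fun e : Feature m n => maxPool h (sample h e) := by
  intro e x B c c₀ η hη
  have hq := fun q : Fin 2 × Fin 2 => abs_le.1 (hη _ (norm_corner_sub_le hh x q.1 q.2))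
  refine abs_le.2 ⟨?_, ?_⟩
  · have h1 := (hq (0, 0)).1
    have h2 := Finset.le_sup' (fun q : Fin 2 × Fin 2 =>
      sample h e (⌊x 0 / h⌋ + (q.1 : ℕ)) (⌊x 1 / h⌋ + (q.2 : ℕ)) B c) (Finset.mem_univ (0, 0))
    exact h1.trans (sub_le_sub_right h2 c₀)
  · rw [sub_le_iff_le_add]
    exact Finset.sup'_le _ _ fun q _ => sub_le_iff_le_add.1 (hq q).2

/-- As the weights sum to `1`, `c₀` can be subtracted inside the sum; nonnegativity then gives a
convex combination of deviations. -/
theorem isLocalAverage_upsample {m n : ℕ} {h : ℝ} (hh : 0 < h) (w : InterpWeights) :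
    IsLocalAverage h fun e : Feature m n => upsample h w (sample h e) := by
  intro e x B c c₀ η hη
  have hq := fun v u => hη _ (norm_corner_sub_le hh x v u)
  have hs := w.sum_eq_one x
  have h1 : upsample h w (sample h e) x B c - c₀ = ∑ v, ∑ u, w.weight x v u *
      (sample h e (⌊x 0 / h⌋ + ((v : Fin 2) : ℕ)) (⌊x 1 / h⌋ + ((u : Fin 2) : ℕ)) B c - c₀) := by
    simp only [mul_sub, Finset.sum_sub_distrib, ← Finset.sum_mul, hs, one_mul]
    rfl
  calc |upsample h w (sample h e) x B c - c₀| ≤ ∑ v, ∑ u, w.weight x v u * η := by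
        rw [h1]
        refine (Finset.abs_sum_le_sum_abs _ _).trans (Finset.sum_le_sum fun v _ =>
          (Finset.abs_sum_le_sum_abs _ _).trans (Finset.sum_le_sum fun u _ => ?_))
        rw [abs_mul, abs_of_nonneg (w.nonneg x v u)]
        exact mul_le_mul_of_nonneg_left (hq v u) (w.nonneg x v u)
    _ = η := by simp only [← Finset.sum_mul, hs, one_mul]

/-- Local averages on a mesh of size at most `K * δ` preserve approximate equivariance. -/
theorem NearEquivariant.localAverage {m n : ℕ} {k : ZMod m} {δ M K h : ℝ} (hδ : 0 < δ)
    (hK : 0 ≤ K) (hh : h ≤ K * δ) {T : Feature m n → Feature m n} (hT : IsLocalAverage h T)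
    {e e' : Feature m n} (H : NearEquivariant k δ M e e') :
    NearEquivariant k δ ((4 * K + 3) * M) (T e) (T e') := by
  have hM := H.left.nonneg
  have hMK := mul_nonneg hK hM
  have hle : M ≤ (4 * K + 3) * M := le_mul_of_one_le_left hM (by linarith)
  -- Points within `2 * h ≤ 2 * K * δ` cost `M * (2 * K * δ + δ)`. Using this at both ends of a
  -- comparison, plus one more `M * δ`, gives `2 * (2 * K + 1) + 1 = 4 * K + 3`.
  have near : ∀ f : Feature m n, SlowlyVarying δ M f → ∀ x B,
      ‖T f x B - f x B‖ ≤ (2 * K + 1) * M * δ := by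
    intro f hf x B
    refine (pi_norm_le_iff_of_nonneg (by positivity)).2 fun c => ?_
    refine hT f x B c (f x B c) _ fun y hy => ?_
    refine (abs_apply_le_norm (f y B - f x B) c).trans ((hf.osc y x B).trans ?_)
    have := mul_le_mul_of_nonneg_left (hy.trans (mul_le_mul_of_nonneg_left hh zero_le_two)) hM
    linarith
  have slow : ∀ f : Feature m n, SlowlyVarying δ M f →
      SlowlyVarying δ ((4 * K + 3) * M) (T f) := by
    intro f hf
    refine ⟨fun x B => (pi_norm_le_iff_of_nonneg (by positivity)).2 fun c => ?_, fun x y B => ?_⟩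
    · have := hT f x B c 0 M fun y _ => by
        rw [sub_zero]
        exact (abs_apply_le_norm _ c).trans (hf.bound y B)
      rw [sub_zero] at this
      exact this.trans hle
    · have h1 := near f hf x B
      have h2 := near f hf y B
      rw [norm_sub_rev] at h2
      have h3 := hf.osc x y B
      have h4 := norm_sub_le_norm_sub_add_norm_sub (T f x B) (f x B) (T f y B)
      have h5 := norm_sub_le_norm_sub_add_norm_sub (f x B) (f y B) (T f y B)
      have h6 := mul_le_mul_of_nonneg_right hle (norm_nonneg (x - y))
      linarith
  refine ⟨slow e H.left, slow e' H.right, fun x B => ?_⟩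
  have h1 := near e H.left x B
  have h2 := near e' H.right (rot (-k) x) (B - k)
  rw [norm_sub_rev] at h2
  have h3 := H.close x B
  have h4 := norm_sub_le_norm_sub_add_norm_sub (T e x B) (e x B) (T e' (rot (-k) x) (B - k))
  have h5 := norm_sub_le_norm_sub_add_norm_sub (e x B) (e' (rot (-k) x) (B - k))
    (T e' (rot (-k) x) (B - k))
  linarith

/-! ### The layers of the network -/

theorem BoundedToOrderTwo.abs_rot_sub_rot_le {m : ℕ} {f : Plane → ℝ} {F G H : ℝ}
    (hf : BoundedToOrderTwo f F G H) (j k : ZMod m) (x : Plane) :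
    |f (rot j x) - f (rot k x)| ≤ |G| * (2 * ‖x‖) := by
  have h1 := norm_sub_le (rot j x) (rot k x)
  rw [norm_rot, norm_rot, ← two_mul] at h1
  exact (hf.abs_sub_le _ _).trans
    ((mul_le_mul_of_nonneg_right (le_abs_self G) (norm_nonneg _)).trans
      (mul_le_mul_of_nonneg_left h1 (abs_nonneg G)))

/-- A filter sum whose weights are samples of rotated latent filters preserves approximate
equivariance. -/
theorem NearEquivariant.latentSum {m n n' p : ℕ} {ι : Type} [Fintype ι]
    {f : Fin n' → ι → Plane → ℝ} {F G H K h δ M : ℝ}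
    (hf : ∀ c' i, BoundedToOrderTwo (f c' i) F G H) (hδ : 0 < δ) (hK : 0 ≤ K) (h0 : 0 ≤ h)
    (hh : h ≤ K * δ) (s a : ι → ZMod m) (κ : ι → Fin n) (u v : ι → Fin p) {k : ZMod m}
    {e e' : Feature m n} (he : NearEquivariant k δ M e e') :
    NearEquivariant k δ (Fintype.card ι *
        (|F| * ((2 * (2 * p * K) + 3) * M) + |G| * (2 * (2 * p * K)) * M))
      (ReDiffuse.filterSum (fun B c' i => f c' i (rot (-(B + s i)) (node h p (u i) (v i))))
        (fun i => node h p (u i) (v i)) a κ e)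
      (ReDiffuse.filterSum (fun B c' i => f c' i (rot (-(B + s i)) (node h p (u i) (v i))))
        (fun i => node h p (u i) (v i)) a κ e') := by
  -- The node radius `2 * p * K` serves as `E`, and through the gradient bound as `D = |G| * (2 *
  -- E)`.
  have hnode : ∀ i, ‖node h p (u i) (v i)‖ ≤ 2 * p * K * δ := fun i => by
    refine (norm_node_le h0 (u i) (v i)).trans ?_
    rw [mul_assoc _ K]
    exact mul_le_mul_of_nonneg_left hh (by positivity)
  refine he.filterSum a κ hδ (abs_nonneg F) (by positivity) (by positivity)
    (fun B c' i => ((hf c' i).bound _).trans (le_abs_self F)) (fun B B' c' i => ?_) hnode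
  refine ((hf c' i).abs_rot_sub_rot_le _ _ _).trans ?_
  rw [mul_assoc |G|, mul_assoc 2]
  gcongr
  exact hnode i

/-- The image becomes a feature map constant in the orientation. The shift `B + 0` matches the
pattern of `latentSum`, whose shift is nontrivial only for the output convolution. -/
theorem liftConv_eq_filterSum {m n n' : ℕ} (h : ℝ) (p : ℕ) (f : Fin n' → Fin n → Plane → ℝ)
    (r : Image n) :
    (liftConv h p f r : Feature m n') = filterSum (ι := Fin n × Fin p × Fin p)
      (fun B c' i => f c' i.1 (rot (-(B + 0)) (node h p i.2.1 i.2.2)))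
      (fun i => node h p i.2.1 i.2.2) (fun _ => 0) (fun i => i.1) (fun x _ => r x) := by
  funext x B c'
  simp only [liftConv, filterSum, Fintype.sum_prod_type, add_zero]

theorem groupConv_eq_filterSum {m n n' : ℕ} [NeZero m] (h : ℝ) (p : ℕ)
    (f : Fin n' → Fin n → ZMod m → Plane → ℝ) (e : Feature m n) :
    groupConv h p f e = filterSum (ι := Fin n × ZMod m × Fin p × Fin p)
      (fun B c' i => f c' i.1 i.2.1 (rot (-(B + 0)) (node h p i.2.2.1 i.2.2.2)))
      (fun i => node h p i.2.2.1 i.2.2.2) (fun i => i.2.1) (fun i => i.1) e := by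
  funext x B c'
  simp only [groupConv, filterSum, Fintype.sum_prod_type, add_zero]

/-- The sum over all orientations can be started from any orientation `B`. -/
theorem outConv_eq_filterSum {m n n' : ℕ} [NeZero m] (h : ℝ) (p : ℕ)
    (f : Fin n' → Fin n → Plane → ℝ) (e : Feature m n) :
    (fun x _ => outConv h p f e x : Feature m n') =
      filterSum (ι := Fin n × ZMod m × Fin p × Fin p)
        (fun B c' i => f c' i.1 (rot (-(B + i.2.1)) (node h p i.2.2.1 i.2.2.2)))
        (fun i => node h p i.2.2.1 i.2.2.2) (fun i => i.2.1) (fun i => i.1) e := by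
  funext x B c'
  simp only [outConv, filterSum, Fintype.sum_prod_type]
  -- `A ↦ B + A` permutes the orientations, so a sum independent of `B` acquires the form of a group
  -- convolution.
  exact Finset.sum_congr rfl fun c _ => (Equiv.sum_comp (Equiv.addLeft B) _).symm

theorem Arch.mesh_nonneg (U : Arch) {δ : ℝ} (hδ : 0 < δ) (l : ℕ) : 0 ≤ U.mesh δ l := by
  unfold Arch.mesh
  split_ifs <;> positivity

theorem Arch.one_le_stride (U : Arch) : (1 : ℝ) ≤ U.stride := by
  exact_mod_cast U.stride_pos

theorem Arch.mesh_le (U : Arch) {δ : ℝ} (hδ : 0 < δ) (l : ℕ) :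
    U.mesh δ l ≤ (U.stride : ℝ) ^ U.depth * δ := by
  unfold Arch.mesh
  split_ifs
  · exact le_rfl
  · exact le_mul_of_one_le_left hδ.le (one_le_pow₀ U.one_le_stride)

/-- The order of quantifiers is the point: `M'` precedes `δ`, the filters and the images. This is
possible because all meshes are at most `stride ^ depth * δ`. -/
theorem NearEquivariant.firstLayer (m : ℕ) [NeZero m] (U : Arch) (F G H : ℕ → ℝ) (M : ℝ) :
    ∃ M', ∀ (δ : ℝ), 0 < δ → ∀ φ : Filters U m, φ.Admissible δ F G H →
      ∀ (k : ZMod m) (r r' : Image (U.chan 0)),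
        NearEquivariant k δ M (fun x _ => r x) (fun x _ => r' x) →
          NearEquivariant k δ M' (firstLayer U δ φ r) (firstLayer U δ φ r') := by
  obtain ⟨M₁, h₁⟩ := NearEquivariant.pointwise (U.pre 0) M
  -- The constant is the output of `latentSum` with `K = stride ^ depth`.
  obtain ⟨M₂, h₂⟩ := NearEquivariant.pointwise (U.post 0)
    (Fintype.card (Fin (U.chan 0) × Fin U.p × Fin U.p) *
    (|F 1| * ((2 * (2 * U.p * (U.stride : ℝ) ^ U.depth) + 3) * M₁) +
      |G 1| * (2 * (2 * U.p * (U.stride : ℝ) ^ U.depth)) * M₁))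
  refine ⟨M₂, fun δ hδ φ hφ k r r' h => h₂ m k δ hδ _ _ ?_⟩
  simp only [liftConv_eq_filterSum]
  exact (h₁ m k δ hδ _ _ h).latentSum (ι := Fin (U.chan 0) × Fin U.p × Fin U.p)
    (fun c' i => (hφ.lift c' i.1).bounded) hδ (by positivity)
    (U.mesh_nonneg hδ 0) (U.mesh_le hδ 0) (fun _ => 0) _ _ _ _

theorem NearEquivariant.midLayer (m : ℕ) [NeZero m] (U : Arch) (F G H : ℕ → ℝ) (l : ℕ)
    (hl : 0 < l) (hl' : l < U.last) (M : ℝ) :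
    ∃ M', ∀ (δ : ℝ), 0 < δ → ∀ φ : Filters U m, φ.Admissible δ F G H →
      ∀ (k : ZMod m) (e e' : Feature m (U.chan l)), NearEquivariant k δ M e e' →
          NearEquivariant k δ M' (midLayer U δ φ l e) (midLayer U δ φ l e') := by
  obtain ⟨M₁, h₁⟩ := NearEquivariant.pointwise (U.pre l) M
  obtain ⟨M₂, h₂⟩ := NearEquivariant.pointwise (U.post l)
    (Fintype.card (Fin (U.chan l) × ZMod m × Fin U.p × Fin U.p) *
    (|F (l + 1)| * ((2 * (2 * U.p * (U.stride : ℝ) ^ U.depth) + 3) * M₁) +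
      |G (l + 1)| * (2 * (2 * U.p * (U.stride : ℝ) ^ U.depth)) * M₁))
  refine ⟨M₂, fun δ hδ φ hφ k e e' h => h₂ m k δ hδ _ _ ?_⟩
  simp only [groupConv_eq_filterSum]
  exact (h₁ m k δ hδ _ _ h).latentSum (ι := Fin (U.chan l) × ZMod m × Fin U.p × Fin U.p)
    (fun c' i => (hφ.mid l hl hl' c' i.1 i.2.1).bounded) hδ (by positivity) (U.mesh_nonneg hδ l) (U.mesh_le hδ l) (fun _ => 0) _ _ _ _

theorem NearEquivariant.lastLayer (m : ℕ) [NeZero m] (U : Arch) (F G H : ℕ → ℝ) (M : ℝ) :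
    ∃ M', ∀ (δ : ℝ), 0 < δ → ∀ φ : Filters U m, φ.Admissible δ F G H →
      ∀ (k : ZMod m) (e e' : Feature m (U.chan U.last)), NearEquivariant k δ M e e' →
          NearEquivariant k δ M' (fun x _ => lastLayer U δ φ e x)
            (fun x _ => lastLayer U δ φ e' x) := by
  obtain ⟨M₁, h₁⟩ := NearEquivariant.pointwise (U.pre U.last) M
  obtain ⟨M₂, h₂⟩ := NearEquivariant.pointwise (U.post U.last)
    (Fintype.card (Fin (U.chan U.last) × ZMod m × Fin U.p × Fin U.p) *
    (|F (U.last + 1)| * ((2 * (2 * U.p * (U.stride : ℝ) ^ U.depth) + 3) * M₁) +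
      |G (U.last + 1)| * (2 * (2 * U.p * (U.stride : ℝ) ^ U.depth)) * M₁))
  refine ⟨M₂, fun δ hδ φ hφ k e e' h => ?_⟩
  have h₃ := (h₁ m k δ hδ _ _ h).latentSum (f := fun c' i => φ.out c' i.1)
    (ι := Fin (U.chan U.last) × ZMod m × Fin U.p × Fin U.p)
    (fun c' i => (hφ.out c' i.1).bounded) hδ (by positivity) (U.mesh_nonneg hδ U.last)
    (U.mesh_le hδ U.last) (fun i => i.2.1) (fun i => i.2.1) (fun i => i.1) (fun i => i.2.2.1)
    (fun i => i.2.2.2)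
  rw [← outConv_eq_filterSum, ← outConv_eq_filterSum] at h₃
  exact h₂ m k δ hδ _ _ h₃

theorem NearEquivariant.midStack (m : ℕ) [NeZero m] (U : Arch) (F G H : ℕ → ℝ) (l t : ℕ)
    (hl : 0 < l) (ht : l + t ≤ U.last) (M : ℝ) :
    ∃ M', ∀ (δ : ℝ), 0 < δ → ∀ φ : Filters U m, φ.Admissible δ F G H →
      ∀ (k : ZMod m) (e e' : Feature m (U.chan l)), NearEquivariant k δ M e e' →
          NearEquivariant k δ M' (midStack U δ φ l t e) (midStack U δ φ l t e') := by
  induction t with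
  | zero => exact ⟨M, fun δ hδ φ hφ k e e' h => h⟩
  | succ t ih =>
    obtain ⟨M₁, h₁⟩ := ih (by omega)
    obtain ⟨M₂, h₂⟩ := NearEquivariant.midLayer m U F G H (l + t) (by omega) (by omega) M₁
    exact ⟨M₂, fun δ hδ φ hφ k e e' h => h₂ δ hδ φ hφ k _ _ (h₁ δ hδ φ hφ k e e' h)⟩

theorem NearEquivariant.poolStack {s : ℕ} (hs : 0 < s) (t : ℕ) (M : ℝ) :
    ∃ M', ∀ (m n : ℕ) (δ : ℝ), 0 < δ → ∀ (k : ZMod m) (e e' : Feature m n),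
      NearEquivariant k δ M e e' →
        NearEquivariant k δ M' (poolStack δ s t e) (poolStack δ s t e') := by
  induction t with
  | zero => exact ⟨M, fun m n δ hδ k e e' h => h⟩
  | succ t ih =>
    obtain ⟨M₁, h₁⟩ := ih
    -- Mesh `s ^ t * δ` means `K = s ^ t`, so the witness is `(4 * s ^ t + 3) * M₁`.
    exact ⟨_, fun m n δ hδ k e e' h => (h₁ m n δ hδ k e e' h).localAverage hδ
      (by positivity : (0 : ℝ) ≤ (s : ℝ) ^ t) le_rfl (isLocalAverage_maxPool (by positivity))⟩

theorem NearEquivariant.upStack {s : ℕ} (hs : 0 < s) (t : ℕ) (M : ℝ) :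
    ∃ M', ∀ (m n : ℕ) (δ : ℝ), 0 < δ → ∀ (w : ℕ → InterpWeights) (k : ZMod m)
      (e e' : Feature m n), NearEquivariant k δ M e e' →
        NearEquivariant k δ M' (upStack δ s w t e) (upStack δ s w t e') := by
  -- The coarsest upsampling acts first, so the induction hypothesis is applied to its output, with
  -- an enlarged constant.
  induction t generalizing M with
  | zero => exact ⟨M, fun m n δ hδ w k e e' h => h⟩
  | succ t ih =>
    obtain ⟨M₁, h₁⟩ := ih ((4 * (s : ℝ) ^ (t + 1) + 3) * M)
    exact ⟨M₁, fun m n δ hδ w k e e' h => h₁ m n δ hδ w k _ _ (h.localAverage hδ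
      (by positivity : (0 : ℝ) ≤ (s : ℝ) ^ (t + 1)) le_rfl
      (isLocalAverage_upsample (by positivity) (w t)))⟩

/-- A Lipschitz image and its rotation form an equivariant pair. -/
theorem NearEquivariant.rotImage {m n : ℕ} (k : ZMod m) {δ F G H : ℝ} (hδ : 0 < δ) {r : Image n}
    (hr : ∀ c, BoundedToOrderTwo (fun x => r x c) F G H) :
    NearEquivariant k δ (|F| + |G|) (fun x _ => rotImage k r x) (fun x _ => r x) := by
  have hF : |F| ≤ |F| + |G| := le_add_of_nonneg_right (abs_nonneg G)
  have hG : |G| ≤ |F| + |G| := le_add_of_nonneg_left (abs_nonneg F)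
  have slow : SlowlyVarying δ (|F| + |G|) (fun x (_ : ZMod m) => r x) := by
    refine ⟨fun x _ => (pi_norm_le_iff_of_nonneg (by positivity)).2 fun c =>
      ((hr c).bound x).trans ((le_abs_self F).trans hF),
      fun x y _ => (pi_norm_le_iff_of_nonneg (by positivity)).2 fun c =>
      ((hr c).abs_sub_le x y).trans ?_⟩
    exact mul_le_mul ((le_abs_self G).trans hG) (le_add_of_nonneg_right hδ.le) (norm_nonneg _)
      (by positivity)
  refine ⟨⟨fun x B => slow.bound _ B, fun x y B => ?_⟩, slow, fun x B => ?_⟩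
  · have := slow.osc (rot (-k) x) (rot (-k) y) B
    rwa [← rot_sub, norm_rot] at this
  · simp only [ReDiffuse.rotImage, sub_self, norm_zero]
    positivity

end ReDiffuse

/-! ### Composition of the layers -/

theorem mainTheorem1 (m : ℕ) [NeZero m] (U : Arch) (F G H : ℕ → ℝ) :
    ∃ C₁ : ℝ, ∀ (δ : ℝ), 0 < δ →
      ∀ (φ : Filters U m), φ.Admissible δ F G H →
      ∀ (w : ℕ → InterpWeights) (r : Image (U.chan 0)),
        (∀ c, BoundedToOrderTwo (fun x => r x c) (F 0) (G 0) (H 0)) →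
      ∀ (k : ZMod m) (x : Plane) (c : Fin (U.chan (U.last + 1))),
        |network U δ φ w (rotImage k r) x c - rotImage k (network U δ φ w r) x c| ≤ C₁ * δ := by
  -- `|F 0| + |G 0|` is the constant of the pair formed by an image and its rotation; all later
  -- constants are chained from it before `δ` is introduced.
  obtain ⟨M₁, h₁⟩ := NearEquivariant.firstLayer m U F G H (|F 0| + |G 0|)
  obtain ⟨M₂, h₂⟩ := NearEquivariant.midStack m U F G H 1 U.kIn (by omega)
    (by simp only [Arch.last]; omega) M₁
  obtain ⟨M₃, h₃⟩ := NearEquivariant.poolStack U.stride_pos U.depth M₂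
  obtain ⟨M₄, h₄⟩ := NearEquivariant.midStack m U F G H (1 + U.kIn) U.kMid (by omega)
    (by simp only [Arch.last]; omega) M₃
  obtain ⟨M₅, h₅⟩ := NearEquivariant.upStack U.stride_pos U.depth M₄
  obtain ⟨M₆, h₆⟩ := NearEquivariant.midStack m U F G H (1 + U.kIn + U.kMid) U.kOut (by omega)
    le_rfl M₅
  obtain ⟨M₇, h₇⟩ := NearEquivariant.lastLayer m U F G H M₆
  refine ⟨M₇, fun δ hδ φ hφ w r hr k x c => ?_⟩
  have h := h₇ δ hδ φ hφ k _ _ (h₆ δ hδ φ hφ k _ _ (h₅ _ _ δ hδ w k _ _ (h₄ δ hδ φ hφ k _ _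
    (h₃ _ _ δ hδ k _ _ (h₂ δ hδ φ hφ k _ _ (h₁ δ hδ φ hφ k _ _
      (NearEquivariant.rotImage k hδ hr)))))))
  -- The output is constant in the orientation, so the choice of `0` is arbitrary.
  exact (abs_apply_le_norm _ c).trans (h.close x 0)
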